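/- Let $Z$ be a (Hausdorff, finite-dimensional) complex manifold and let $Y\subset Z$ be a complex submanifold (locally closed, embedded, with its induced complex structure) whose closure $\overline Y$ in $Z$ is compact. Let $L$ be a length function on $Z$, i.e. a continuous function $L:T_Z\to[0,\infty)$ on the holomorphic tangent bundle with $L(cv)=|c|\,L(v)$ for $c\in\mathbb C$ and $L(v)>0$ for $v\neq 0$. For a complex manifold $X$, let $\Delta\subset\mathbb C$ be the unit disk and, for $x\in X$ and $\xi\in T_{X,x}$, let $$k_X(\xi)=\inf\{\lambda>0:\ \exists\, f:\Delta\to X \text{ holomorphic},\ f(0)=x,\ \lambda f'(0)=\xi\}$$ be the Kobayashi--Royden infinitesimal pseudometric. Let $d_X(x,x')$ be the Kobayashi pseudodistance, i.e. the infimum of $\int_0^1 k_X(\gamma'(t))\,dt$ over all piecewise $C^1$ paths $\gamma:[0,1]\to X$ from $x$ to $x'$ (with $d_X(x,x')=\infty$ if there is no such path). One says that $Y$ is hyperbolically imbedded in $Z$ if for every pair of distinct points $p,q\in\overline Y$ there are neighborhoods $U_p$ of $p$ and $U_q$ of $q$ in $Z$ such that $$d_Y(U_p\cap Y,\,U_q\cap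 Y)=\inf\{d_Y(a,b):\ a\in U_p\cap Y,\ b\in U_q\cap Y\}>0.$$ Then the following are equivalent: (a) $Y$ is hyperbolically imbedded in $Z$; (b) there is a constant $\varepsilon>0$ such that $k_Y(v)\ge \varepsilon\,L(v)$ for every $y\in Y$ and every $v\in T_{Y,y}\subset T_{Z,y}$. -/

import Mathlib

open Set MeasureTheory
open scoped Manifold ENNReal ContDiff Topology

noncomputable section

/-- The Kobayashi-Royden infinitesimal pseudometric of a complex manifold `X` modelled on `E`:
`k_X(ξ)` is the infimum of the `r > 0` such that `r f'(0) = ξ` for some holomorphic map `f` from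
the unit disk to `X`. The equation takes place in the tangent bundle, so that it contains
`f(0) = x` for `ξ` a tangent vector at `x`. -/
def kobayashiRoyden (E : Type*) [NormedAddCommGroup E] [NormedSpace ℂ E]
    {X : Type*} [TopologicalSpace X] [ChartedSpace E X]
    (ξ : TangentBundle 𝓘(ℂ, E) X) : ℝ≥0∞ :=
  sInf {c : ℝ≥0∞ | ∃ r : ℝ, 0 < r ∧ c = ENNReal.ofReal r ∧ ∃ f : ℂ → X,
    MDifferentiableOn 𝓘(ℂ, ℂ) 𝓘(ℂ, E) f (Metric.ball (0 : ℂ) 1) ∧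
    (⟨f 0, (r : ℂ) • (mfderiv 𝓘(ℂ, ℂ) 𝓘(ℂ, E) f 0 (1 : ℂ) : E)⟩ : TangentBundle 𝓘(ℂ, E) X) = ξ}

/-- `γ` is a piecewise `C^1` path on `[0, 1]` in the real manifold underlying `X`. -/
def IsPiecewiseC1Path (E : Type*) [NormedAddCommGroup E] [NormedSpace ℂ E]
    {X : Type*} [TopologicalSpace X] [ChartedSpace E X] (γ : ℝ → X) : Prop :=
  ∃ (n : ℕ) (t : ℕ → ℝ), Monotone t ∧ t 0 = 0 ∧ t n = 1 ∧
    ∀ i < n, ContMDiffOn 𝓘(ℝ, ℝ) 𝓘(ℝ, E) 1 γ (Icc (t i) (t (i + 1)))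

/-- The length `∫₀¹ k_X(γ'(t)) dt` of a path. The real and the complex tangent space at a point are
both the model space `E`, read in the same preferred chart, so that the real velocity vector `γ'(t)`
is a vector of the complex tangent bundle. -/
def kobayashiLength (E : Type*) [NormedAddCommGroup E] [NormedSpace ℂ E]
    {X : Type*} [TopologicalSpace X] [ChartedSpace E X] (γ : ℝ → X) : ℝ≥0∞ :=
  ∫⁻ t in Icc (0 : ℝ) 1,
    kobayashiRoyden E
      (⟨γ t, (mfderiv 𝓘(ℝ, ℝ) 𝓘(ℝ, E) γ t (1 : ℝ) : E)⟩ : TangentBundle 𝓘(ℂ, E) X)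

/-- The Kobayashi pseudodistance `d_X`: the infimum of the lengths of the piecewise `C^1` paths
from `x` to `y` (it is `∞` if there is no such path, that is, if `x` and `y` lie in different
components). -/
def kobayashiEDist (E : Type*) [NormedAddCommGroup E] [NormedSpace ℂ E]
    {X : Type*} [TopologicalSpace X] [ChartedSpace E X] (x y : X) : ℝ≥0∞ :=
  sInf {ℓ : ℝ≥0∞ | ∃ γ : ℝ → X, IsPiecewiseC1Path E γ ∧ γ 0 = x ∧ γ 1 = y ∧
    ℓ = kobayashiLength E γ}

/-- `Y ⊆ Z` is hyperbolically imbedded in `Z`: any two distinct points `p`, `q` of the closure of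
`Y` in `Z` have neighborhoods `U`, `V` in `Z` with `d_Y(U ∩ Y, V ∩ Y) > 0`, where the distance
between two sets is the infimum of the distances of their points. -/
def IsHyperbolicallyImbedded (F : Type*) [NormedAddCommGroup F] [NormedSpace ℂ F]
    {Z : Type*} [TopologicalSpace Z] (Y : Set Z) [ChartedSpace F Y] : Prop :=
  ∀ p ∈ closure Y, ∀ q ∈ closure Y, p ≠ q → ∃ U ∈ 𝓝 p, ∃ V ∈ 𝓝 q,
    0 < sInf {d : ℝ≥0∞ | ∃ a b : Y, (a : Z) ∈ U ∧ (b : Z) ∈ V ∧ d = kobayashiEDist F a b}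

/-- A length function on a complex manifold `Z`: a continuous function `L` on the tangent bundle
with `L(cv) = |c| L(v)` for complex `c`, and with `L(v) > 0` for `v ≠ 0`. -/
structure IsLengthFunction (E : Type*) [NormedAddCommGroup E] [NormedSpace ℂ E]
    (Z : Type*) [TopologicalSpace Z] [ChartedSpace E Z] [IsManifold 𝓘(ℂ, E) 1 Z]
    (L : TangentBundle 𝓘(ℂ, E) Z → ℝ) : Prop where
  continuous : Continuous L
  map_smul : ∀ (z : Z) (c : ℂ) (v : TangentSpace 𝓘(ℂ, E) z), L ⟨z, c • v⟩ = ‖c‖ * L ⟨z, v⟩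
  pos : ∀ (z : Z) (v : TangentSpace 𝓘(ℂ, E) z), v ≠ 0 → 0 < L ⟨z, v⟩

end

/-! Both directions work in a chart ball about a point `p`, where `L` is comparable to the norm of
the vector read in the chart (`IsLengthFunction.exists_chart_bounds`).

(b) ⇒ (a): a path in `Y` from near `p` to near `q` must leave the chart ball, and until then `k_Y`
dominates a constant times its Euclidean speed. Its length is therefore bounded below
(`IsLengthFunction.exists_pos_le_kobayashiLength`).

(a) ⇒ (b): the points `f z` of a holomorphic disc are `d_Y`-close to `f 0` for small `z`
(`kobayashiEDist_le_of_disc`), whereas points of `Y` near `p` are `d_Y`-far from the chart sphere.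
So a disc centred near `p`, cut to a fixed radius, cannot cross the sphere, and Cauchy's estimate
bounds its derivative at `0`. Compactness of the closure makes this bound uniform, and its inverse
serves as `ε`. -/

section RestrictScalars

variable {F : Type*} [NormedAddCommGroup F] [NormedSpace ℂ F]
  {X : Type*} [TopologicalSpace X] [ChartedSpace F X]
  {G : Type*} [NormedAddCommGroup G] [NormedSpace ℂ G]
  {Y : Type*} [TopologicalSpace Y] [ChartedSpace G Y]

theorem HasMFDerivAt.real_of_complex {f : X → Y} {x : X} {f' : F →L[ℂ] G}
    (hf : HasMFDerivAt 𝓘(ℂ, F) 𝓘(ℂ, G) f x f') :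
    HasMFDerivAt 𝓘(ℝ, F) 𝓘(ℝ, G) f x (f'.restrictScalars ℝ : F →L[ℝ] G) :=
  ⟨hf.1, HasFDerivWithinAt.restrictScalars ℝ hf.2⟩

theorem ContMDiffAt.real_of_complex {f : X → Y} {x : X} {n : ℕ∞ω}
    (hf : ContMDiffAt 𝓘(ℂ, F) 𝓘(ℂ, G) n f x) :
    ContMDiffAt 𝓘(ℝ, F) 𝓘(ℝ, G) n f x := by
  rw [contMDiffAt_iff] at hf ⊢
  exact ⟨hf.1, ContDiffWithinAt.restrict_scalars ℝ hf.2⟩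

/-- In a chart of the target, one complex derivative on an open set gives analyticity. This makes
radial paths in a disc `C^1`. -/
theorem MDifferentiableOn.contMDiffAt_of_isOpen [CompleteSpace F] [IsManifold 𝓘(ℂ, F) 1 X]
    {f : ℂ → X} {s : Set ℂ} (hf : MDifferentiableOn 𝓘(ℂ, ℂ) 𝓘(ℂ, F) f s) (hs : IsOpen s)
    {w : ℂ} (hw : w ∈ s) {n : ℕ∞ω} : ContMDiffAt 𝓘(ℂ, ℂ) 𝓘(ℂ, F) n f w := by
  have hc : ContinuousOn f s := hf.continuousOn
  rw [contMDiffAt_iff_target]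
  refine ⟨hc.continuousAt (hs.mem_nhds hw), ?_⟩
  have ho : IsOpen (s ∩ f ⁻¹' (chartAt F (f w)).source) :=
    hc.isOpen_inter_preimage hs (chartAt F (f w)).open_source
  have hd : DifferentiableOn ℂ (extChartAt 𝓘(ℂ, F) (f w) ∘ f)
      (s ∩ f ⁻¹' (chartAt F (f w)).source) := by
    rw [← mdifferentiableOn_iff_differentiableOn]
    exact mdifferentiableOn_extChartAt.comp (hf.mono inter_subset_left) inter_subset_right
  rw [contMDiffAt_iff_contDiffAt]
  exact (hd.analyticAt (ho.mem_nhds ⟨hw, mem_chart_source F (f w)⟩)).contDiffAt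

theorem HasMFDerivAt.hasDerivAt_comp_path {h : X → G} {γ : ℝ → X} {t : ℝ} {h' : F →L[ℂ] G}
    (hh : HasMFDerivAt 𝓘(ℂ, F) 𝓘(ℂ, G) h (γ t) h')
    (hγ : MDifferentiableAt 𝓘(ℝ, ℝ) 𝓘(ℝ, F) γ t) :
    HasDerivAt (h ∘ γ) (h' (mfderiv 𝓘(ℝ, ℝ) 𝓘(ℝ, F) γ t (1 : ℝ) : F)) t := by
  have := (HasMFDerivAt.real_of_complex hh).comp t hγ.hasMFDerivAt
  set D : ℝ →L[ℝ] F := mfderiv 𝓘(ℝ, ℝ) 𝓘(ℝ, F) γ t with hD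
  have hfd : HasFDerivAt (h ∘ γ) ((h'.restrictScalars ℝ : F →L[ℝ] G).comp D) t :=
    hasMFDerivAt_iff_hasFDerivAt.1 this
  exact hfd.hasDerivAt

end RestrictScalars

/-! ### Kobayashi distance along a holomorphic disc -/

section Disc

variable {F : Type*} [NormedAddCommGroup F] [NormedSpace ℂ F]
  {X : Type*} [TopologicalSpace X] [ChartedSpace F X]

/-- Precompose `f` with `s ↦ w + (ζ / r) s`, which maps the unit disk into itself since `‖w‖` and
`‖ζ / r‖` are at most `1 / 2`. This crude bound replaces the Poincaré metric. -/
theorem kobayashiRoyden_le_of_disc {f : ℂ → X}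
    (hf : MDifferentiableOn 𝓘(ℂ, ℂ) 𝓘(ℂ, F) f (Metric.ball (0 : ℂ) 1))
    {w ζ : ℂ} (hw : ‖w‖ < 1 / 2) {r : ℝ} (hr : 0 < r) (hζ : ‖ζ‖ ≤ r / 2) :
    kobayashiRoyden F (⟨f w, (mfderiv 𝓘(ℂ, ℂ) 𝓘(ℂ, F) f w ζ : F)⟩ : TangentBundle 𝓘(ℂ, F) X) ≤
      ENNReal.ofReal r := by
  set a : ℂ → ℂ := fun s => w + (ζ / r) * s with ha
  have ha0 : a 0 = w := by simp [ha]
  have hmaps : MapsTo a (Metric.ball 0 1) (Metric.ball 0 1) := by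
    intro s hs
    rw [mem_ball_zero_iff] at hs ⊢
    have h1 : ‖ζ / r‖ ≤ 1 / 2 := by
      rw [norm_div, Complex.norm_real, Real.norm_of_nonneg hr.le, div_le_iff₀ hr]; linarith
    calc ‖w + (ζ / r) * s‖ ≤ ‖w‖ + ‖ζ / r‖ * ‖s‖ := (norm_add_le _ _).trans (by rw [norm_mul])
      _ ≤ ‖w‖ + 1 / 2 * 1 := by gcongr
      _ < 1 := by linarith
  have hda : ∀ s, HasDerivAt a (ζ / r) s := fun s => by
    have h := ((hasDerivAt_id s).const_mul (ζ / (r : ℂ))).const_add w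
    rwa [mul_one] at h
  refine sInf_le ⟨r, hr, rfl, f ∘ a, ?_, ?_⟩
  · refine hf.comp ?_ hmaps
    rw [mdifferentiableOn_iff_differentiableOn]
    exact fun s _ => (hda s).differentiableAt.differentiableWithinAt
  · have hwb : w ∈ Metric.ball (0 : ℂ) 1 := by rw [mem_ball_zero_iff]; linarith
    have hfw : MDifferentiableAt 𝓘(ℂ, ℂ) 𝓘(ℂ, F) f (a 0) := by
      rw [ha0]; exact hf.mdifferentiableAt (Metric.isOpen_ball.mem_nhds hwb)
    have hcomp := hfw.hasMFDerivAt.comp (0 : ℂ) (hda 0).hasFDerivAt.hasMFDerivAt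
    rw [hcomp.mfderiv]
    have hr' : (r : ℂ) ≠ 0 := by exact_mod_cast hr.ne'
    have hlin : ∀ D : ℂ →L[ℂ] F,
        (r : ℂ) • D (ContinuousLinearMap.toSpanSingleton ℂ (ζ / (r : ℂ)) 1) = D ζ := fun D => by
      rw [← map_smul, ContinuousLinearMap.toSpanSingleton_apply, one_smul, smul_eq_mul,
        mul_div_cancel₀ _ hr']
    have key : (⟨f (a 0), (mfderiv 𝓘(ℂ, ℂ) 𝓘(ℂ, F) f (a 0) ζ : F)⟩ : TangentBundle 𝓘(ℂ, F) X) =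
        ⟨f w, (mfderiv 𝓘(ℂ, ℂ) 𝓘(ℂ, F) f w ζ : F)⟩ := by rw [ha0]
    exact (congrArg (Bundle.TotalSpace.mk (F := F) (E := TangentSpace 𝓘(ℂ, F)) (f (a 0)))
      (hlin (mfderiv 𝓘(ℂ, ℂ) 𝓘(ℂ, F) f (a 0)))).trans key

theorem kobayashiEDist_le_of_disc [CompleteSpace F] [IsManifold 𝓘(ℂ, F) 1 X] {f : ℂ → X}
    (hf : MDifferentiableOn 𝓘(ℂ, ℂ) 𝓘(ℂ, F) f (Metric.ball (0 : ℂ) 1))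
    {z : ℂ} (hz : ‖z‖ < 1 / 2) {r : ℝ} (hr : 0 < r) (hzr : ‖z‖ ≤ r / 2) :
    kobayashiEDist F (f 0) (f z) ≤ ENNReal.ofReal r := by
  -- The image of a radial segment: its velocity is the derivative of `f` applied to `z`.
  set γ : ℝ → X := fun t => f (t * z) with hγ
  have hda : ∀ t : ℝ, HasDerivAt (fun t : ℝ => (t : ℂ) * z) z t := fun t => by
    simpa using (Complex.ofRealCLM.hasDerivAt (x := t)).mul_const z
  have hnorm : ∀ t ∈ Icc (0 : ℝ) 1, ‖(t : ℂ) * z‖ < 1 / 2 := fun t ht => by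
    rw [norm_mul, Complex.norm_real, Real.norm_of_nonneg ht.1]
    exact (mul_le_of_le_one_left (norm_nonneg z) ht.2).trans_lt hz
  have hball : ∀ t ∈ Icc (0 : ℝ) 1, (t : ℂ) * z ∈ Metric.ball (0 : ℂ) 1 := fun t ht => by
    rw [mem_ball_zero_iff]; linarith [hnorm t ht]
  have hpath : IsPiecewiseC1Path F γ := by
    refine ⟨1, fun i => i, Nat.mono_cast, by simp, by simp, fun i hi => ?_⟩
    obtain rfl : i = 0 := by omega
    intro t ht
    have ht' : t ∈ Icc (0 : ℝ) 1 := by simpa using ht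
    have h1 : ContMDiffAt 𝓘(ℝ, ℂ) 𝓘(ℝ, F) 1 f (t * z) :=
      (hf.contMDiffAt_of_isOpen Metric.isOpen_ball (hball t ht')).real_of_complex
    have h2 : ContMDiffAt 𝓘(ℝ, ℝ) 𝓘(ℝ, ℂ) 1 (fun t : ℝ => (t : ℂ) * z) t := by
      rw [contMDiffAt_iff_contDiffAt]
      exact (Complex.ofRealCLM.contDiff.mul contDiff_const).contDiffAt
    exact (ContMDiffAt.comp t h1 h2).contMDiffWithinAt
  have hle : kobayashiEDist F (f 0) (f z) ≤ kobayashiLength F γ :=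
    sInf_le ⟨γ, hpath, by simp [hγ], by simp [hγ], rfl⟩
  refine hle.trans ?_
  have hk : ∀ t ∈ Icc (0 : ℝ) 1, kobayashiRoyden F
      (⟨γ t, (mfderiv 𝓘(ℝ, ℝ) 𝓘(ℝ, F) γ t (1 : ℝ) : F)⟩ : TangentBundle 𝓘(ℂ, F) X) ≤
      ENNReal.ofReal r := by
    intro t ht
    have hfd := (hf.mdifferentiableAt (Metric.isOpen_ball.mem_nhds (hball t ht))).hasMFDerivAt
    have h1 := (HasMFDerivAt.real_of_complex hfd).comp t (hda t).hasFDerivAt.hasMFDerivAt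
    have h2 : (mfderiv 𝓘(ℝ, ℝ) 𝓘(ℝ, F) γ t (1 : ℝ) : F) =
        (mfderiv 𝓘(ℂ, ℂ) 𝓘(ℂ, F) f (t * z) z : F) := by
      have h3 : ∀ D : ℂ →L[ℂ] F,
          ((D.restrictScalars ℝ).comp (ContinuousLinearMap.toSpanSingleton ℝ z)) 1 = D z :=
        fun D => by simp
      exact (congrArg (fun A : ℝ →L[ℝ] F => A 1) h1.mfderiv).trans
        (h3 (mfderiv 𝓘(ℂ, ℂ) 𝓘(ℂ, F) f (t * z)))
    rw [h2]
    exact kobayashiRoyden_le_of_disc hf (hnorm t ht) hr hzr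
  calc kobayashiLength F γ ≤ ∫⁻ _ in Icc (0 : ℝ) 1, ENNReal.ofReal r :=
        setLIntegral_mono measurable_const hk
    _ = ENNReal.ofReal r := by simp

end Disc

/-! ### Piecewise `C^1` paths and the fundamental theorem of calculus -/

section Paths

variable {F : Type*} [NormedAddCommGroup F] [NormedSpace ℂ F]
  {X : Type*} [TopologicalSpace X] [ChartedSpace F X]

theorem IsPiecewiseC1Path.continuousOn {γ : ℝ → X} (hγ : IsPiecewiseC1Path F γ) :
    ContinuousOn γ (Icc 0 1) := by
  obtain ⟨n, t, hmono, h0, h1, hC⟩ := hγ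
  have : ∀ k ≤ n, ContinuousOn γ (Icc (t 0) (t k)) := by
    intro k
    induction k with
    | zero => intro _; simp
    | succ k ih =>
      intro hk
      rw [← Icc_union_Icc_eq_Icc (hmono (Nat.zero_le k)) (hmono (Nat.le_succ k))]
      exact (ih (by omega)).union_of_isClosed (hC k (by omega)).continuousOn isClosed_Icc
        isClosed_Icc
  simpa [h0, h1] using this n le_rfl

theorem IsPiecewiseC1Path.exists_countable_mdifferentiableAt {γ : ℝ → X}
    (hγ : IsPiecewiseC1Path F γ) :
    ∃ S : Set ℝ, S.Countable ∧ ∀ s ∈ Icc (0 : ℝ) 1 \ S, MDifferentiableAt 𝓘(ℝ, ℝ) 𝓘(ℝ, F) γ s := by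
  obtain ⟨n, t, hmono, h0, h1, hC⟩ := hγ
  refine ⟨range t, countable_range t, fun s ⟨hs, hst⟩ => ?_⟩
  have hne : ∀ i, t i ≠ s := fun i h => hst ⟨i, h⟩
  have : ∀ k ≤ n, s < t k → ∃ i < n, t i < s ∧ s < t (i + 1) := by
    intro k
    induction k with
    | zero => intro _ h; rw [h0] at h; exact absurd hs.1 (not_le.2 h)
    | succ k ih =>
      intro hk h
      rcases lt_or_gt_of_ne (hne k) with h' | h'
      · exact ⟨k, by omega, h', h⟩
      · exact ih (by omega) h'
  obtain ⟨i, hi, hl, hr⟩ := this n le_rfl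
    (lt_of_le_of_ne (by rw [h1]; exact hs.2) (hne n).symm)
  exact ((hC i hi).contMDiffAt (Icc_mem_nhds hl hr)).mdifferentiableAt one_ne_zero

theorem enorm_sub_le_lintegral_deriv_off_countable {E : Type*} [NormedAddCommGroup E]
    [NormedSpace ℝ E] [CompleteSpace E] {u : ℝ → E} {a b : ℝ} (hab : a ≤ b)
    (hc : ContinuousOn u (Icc a b)) {S : Set ℝ} (hS : S.Countable)
    (hd : ∀ s ∈ Ioo a b \ S, DifferentiableAt ℝ u s) :
    ‖u b - u a‖ₑ ≤ ∫⁻ s in Ioc a b, ‖deriv u s‖ₑ := by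
  by_cases htop : ∫⁻ s in Ioc a b, ‖deriv u s‖ₑ = ⊤
  · simp [htop]
  have hint : IntervalIntegrable (deriv u) volume a b := by
    rw [intervalIntegrable_iff_integrableOn_Ioc_of_le hab]
    exact ⟨(stronglyMeasurable_deriv u).aestronglyMeasurable, lt_top_iff_ne_top.2 htop⟩
  rw [← integral_eq_of_hasDerivAt_off_countable_of_le u (deriv u) hab hS hc
    (fun s hs => (hd s hs).hasDerivAt) hint, intervalIntegral.integral_of_le hab]
  exact enorm_integral_le_lintegral_enorm _

end Paths

/-! ### Length functions in a chart -/

section LengthFunction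

variable {E : Type*} [NormedAddCommGroup E] [NormedSpace ℂ E]
  {Z : Type*} [TopologicalSpace Z] [ChartedSpace E Z] [IsManifold 𝓘(ℂ, E) 1 Z]
  {L : TangentBundle 𝓘(ℂ, E) Z → ℝ}

/-- In the trivialization at `p`, `L` is continuous and positive on the compact set `K` times the
unit sphere; homogeneity extends the bounds to all vectors. -/
theorem IsLengthFunction.exists_chart_bounds [FiniteDimensional ℂ E]
    (hL : IsLengthFunction E Z L) (p : Z)
    {K : Set Z} (hK : IsCompact K) (hKs : K ⊆ (chartAt E p).source) :
    ∃ c M : ℝ, 0 < c ∧ 0 < M ∧ ∀ y ∈ K, ∃ D : E →L[ℂ] E,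
      HasMFDerivAt 𝓘(ℂ, E) 𝓘(ℂ, E) (extChartAt 𝓘(ℂ, E) p) y D ∧
      ∀ v : E, c * ‖D v‖ ≤ L ⟨y, v⟩ ∧ L ⟨y, v⟩ ≤ M * ‖D v‖ := by
  have : ProperSpace E := FiniteDimensional.proper ℂ E
  set e := trivializationAt E (TangentSpace 𝓘(ℂ, E) : Z → Type _) p with he
  have hbase : ∀ y ∈ K, y ∈ e.baseSet := fun y hy =>
    (TangentBundle.trivializationAt_baseSet (I := 𝓘(ℂ, E)) p).symm.subset (hKs hy)
  set g : Z × E → ℝ := fun x => L ⟨x.1, e.symm x.1 x.2⟩ with hg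
  have hcont : ContinuousOn g (K ×ˢ Metric.sphere (0 : E) 1) :=
    hL.continuous.comp_continuousOn
      (e.continuousOn_symm.mono (prod_mono hbase (subset_univ _)))
  have hcomp : IsCompact (K ×ˢ Metric.sphere (0 : E) 1) := hK.prod (isCompact_sphere 0 1)
  have hpos : ∀ x ∈ K ×ˢ Metric.sphere (0 : E) 1, 0 < g x := by
    rintro ⟨y, w⟩ ⟨hy, hw⟩
    refine hL.pos y _ fun h0 => ?_
    have h1 := e.continuousLinearMapAt_symmL (R := ℂ) (hbase y hy) w
    rw [e.symmL_apply (R := ℂ) (hbase y hy), h0, map_zero] at h1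
    simp [← h1] at hw
  obtain ⟨c, hc, hcb⟩ := hcomp.exists_forall_le' hcont hpos
  obtain ⟨M, hM⟩ := hcomp.exists_bound_of_continuousOn hcont
  refine ⟨c, max M 1, hc, by positivity, fun y hy => ?_⟩
  set T : E →L[ℂ] E := e.continuousLinearMapAt ℂ y with hT
  refine ⟨T, ?_, fun v => ?_⟩
  · rw [hT]
    rw [TangentBundle.continuousLinearMapAt_trivializationAt (hKs hy)]
    exact (mdifferentiableAt_extChartAt (hKs hy)).hasMFDerivAt
  set w : E := T v with hw
  set R : E →L[ℂ] E := e.symmL ℂ y with hR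
  have hRs : ∀ x, R x = e.symm y x := fun x => e.symmL_apply (R := ℂ) (hbase y hy) x
  have hv : R w = v := e.symmL_continuousLinearMapAt (R := ℂ) (hbase y hy) v
  rcases eq_or_ne w 0 with h0 | h0
  · have hv0 : L ⟨y, v⟩ = 0 := by
      have h1 : v = (0 : ℂ) • v := by rw [← hv, h0, map_zero, smul_zero]
      rw [h1]
      exact (hL.map_smul y 0 v).trans (by simp)
    simp [h0, hv0]
  · have hn : ‖w‖ ≠ 0 := norm_ne_zero_iff.2 h0
    have hmem : (y, (‖w‖ : ℂ)⁻¹ • w) ∈ K ×ˢ Metric.sphere (0 : E) 1 :=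
      ⟨hy, by simp [norm_smul, hn]⟩
    have hLv : L ⟨y, v⟩ = ‖w‖ * g (y, (‖w‖ : ℂ)⁻¹ • w) := by
      have h1 : v = (‖w‖ : ℂ) • R ((‖w‖ : ℂ)⁻¹ • w) := by
        rw [← _root_.map_smul, smul_smul, mul_inv_cancel₀ (by exact_mod_cast hn), one_smul, hv]
      conv_lhs => rw [h1]
      refine (hL.map_smul y _ _).trans ?_
      simp [hg, hRs]
    rw [hLv, mul_comm c, mul_comm (max M 1)]
    exact ⟨mul_le_mul_of_nonneg_left (hcb _ hmem) (norm_nonneg _),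
      mul_le_mul_of_nonneg_left ((le_abs_self _).trans ((hM _ hmem).trans (le_max_left _ _)))
        (norm_nonneg _)⟩

end LengthFunction

/-! ### Chart balls -/

section Chart

variable {E : Type*} [NormedAddCommGroup E] [NormedSpace ℂ E]
  {Z : Type*} [TopologicalSpace Z] [ChartedSpace E Z]

theorem exists_isCompact_chart_closedBall [ProperSpace E] {p : Z} {N : Set Z} (hN : N ∈ 𝓝 p) :
    ∃ r : ℝ, 0 < r ∧ ∃ K : Set Z, IsCompact K ∧ K ⊆ N ∧ K ⊆ (chartAt E p).source ∧
      ∀ y ∈ (chartAt E p).source,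
        (y ∈ K ↔ extChartAt 𝓘(ℂ, E) p y ∈ Metric.closedBall (extChartAt 𝓘(ℂ, E) p p) r) := by
  set φ := chartAt E p with hφ
  have hp : p ∈ φ.source := mem_chart_source E p
  have hnhds : φ.target ∩ φ.symm ⁻¹' N ∈ 𝓝 (φ p) := by
    refine Filter.inter_mem (φ.open_target.mem_nhds (φ.map_source hp)) ?_
    exact (φ.continuousAt_symm (φ.map_source hp)).preimage_mem_nhds (by rwa [φ.left_inv hp])
  obtain ⟨r, hr, hsub⟩ := Metric.nhds_basis_closedBall.mem_iff.1 hnhds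
  refine ⟨r, hr, φ.symm '' Metric.closedBall (φ p) r, ?_, ?_, ?_, fun y hy => ?_⟩
  · exact (isCompact_closedBall _ _).image_of_continuousOn
      (φ.continuousOn_symm.mono fun x hx => (hsub hx).1)
  · rintro _ ⟨x, hx, rfl⟩
    exact (hsub hx).2
  · rintro _ ⟨x, hx, rfl⟩
    exact φ.map_target (hsub hx).1
  · have h1 : ∀ z, extChartAt 𝓘(ℂ, E) p z = φ z := fun z => rfl
    rw [h1, h1]
    constructor
    · rintro ⟨x, hx, rfl⟩
      rwa [φ.right_inv (hsub hx).1]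
    · exact fun h => ⟨φ y, h, φ.left_inv hy⟩

theorem isOpen_chart_ball (p : Z) (r : ℝ) :
    IsOpen ((chartAt E p).source ∩
      extChartAt 𝓘(ℂ, E) p ⁻¹' Metric.ball (extChartAt 𝓘(ℂ, E) p p) r) :=
  (chartAt E p).isOpen_inter_preimage Metric.isOpen_ball

end Chart

/-! ### From the infinitesimal bound to hyperbolic imbedding -/

section LowerBound

variable {E : Type*} [NormedAddCommGroup E] [NormedSpace ℂ E] [FiniteDimensional ℂ E]
  {Z : Type*} [TopologicalSpace Z] [T2Space Z] [ChartedSpace E Z] [IsManifold 𝓘(ℂ, E) 1 Z]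
  {L : TangentBundle 𝓘(ℂ, E) Z → ℝ}
  {F : Type*} [NormedAddCommGroup F] [NormedSpace ℂ F]
  {X : Type*} [TopologicalSpace X] [ChartedSpace F X]

theorem IsLengthFunction.exists_pos_le_kobayashiLength (hL : IsLengthFunction E Z L) {ι : X → Z}
    (hι : MDifferentiable 𝓘(ℂ, F) 𝓘(ℂ, E) ι) {ε : ℝ} (hε : 0 < ε)
    (hk : ∀ (y : X) (v : TangentSpace 𝓘(ℂ, F) y),
      ENNReal.ofReal (ε * L ⟨ι y, mfderiv 𝓘(ℂ, F) 𝓘(ℂ, E) ι y v⟩) ≤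
        kobayashiRoyden F (⟨y, v⟩ : TangentBundle 𝓘(ℂ, F) X))
    {p q : Z} (hpq : p ≠ q) :
    ∃ U ∈ 𝓝 p, ∃ V ∈ 𝓝 q, ∃ δ : ℝ, 0 < δ ∧ ∀ γ : ℝ → X, IsPiecewiseC1Path F γ →
      ι (γ 0) ∈ U → ι (γ 1) ∈ V → ENNReal.ofReal δ ≤ kobayashiLength F γ := by
  have : ProperSpace E := FiniteDimensional.proper ℂ E
  have : CompleteSpace E := FiniteDimensional.complete ℂ E
  obtain ⟨r, hr, K, hK, hKN, hKs, hmemK⟩ :=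
    exists_isCompact_chart_closedBall (E := E) (isOpen_compl_singleton.mem_nhds hpq)
  obtain ⟨c, _, hc, _, hbound⟩ := hL.exists_chart_bounds p hK hKs
  set φ := extChartAt 𝓘(ℂ, E) p with hφ
  have hps : p ∈ (chartAt E p).source := mem_chart_source E p
  have hφc : ContinuousOn φ (chartAt E p).source := (chartAt E p).continuousOn
  set W : ℝ → Set Z := fun s => (chartAt E p).source ∩ φ ⁻¹' Metric.ball (φ p) s with hW
  have hWo : ∀ s, IsOpen (W s) := isOpen_chart_ball p
  -- Starting in the half ball and ending outside `K` forces a displacement of at least `r / 2` in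
  -- the chart.
  refine ⟨W (r / 2), (hWo _).mem_nhds ⟨hps, Metric.mem_ball_self (by positivity)⟩, Kᶜ,
    hK.isClosed.isOpen_compl.mem_nhds fun h => hKN h rfl, ε * c * (r / 2), by positivity, ?_⟩
  intro γ hγ h0 h1
  set g : ℝ → Z := ι ∘ γ with hg
  have hgc : ContinuousOn g (Icc 0 1) := hι.continuous.comp_continuousOn hγ.continuousOn
  have hWK : W r ⊆ K := fun y hy => (hmemK y hy.1).2 (Metric.ball_subset_closedBall hy.2)
  have hTclosed : IsClosed (Icc (0 : ℝ) 1 ∩ g ⁻¹' (W r)ᶜ) :=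
    hgc.preimage_isClosed_of_isClosed isClosed_Icc (hWo r).isClosed_compl
  -- The first exit time from the open ball; up to and including `τ` the path stays in `K`, hence in
  -- the chart domain.
  obtain ⟨τ, ⟨hτ01, hτW⟩, hτmin⟩ :=
    (isCompact_Icc.of_isClosed_subset hTclosed inter_subset_left).exists_isLeast
      ⟨1, ⟨by simp, fun h => h1 (hWK h)⟩⟩
  have hbefore : ∀ s ∈ Ico 0 τ, g s ∈ W r := fun s hs => by
    by_contra h
    exact absurd (hτmin ⟨⟨hs.1, hs.2.le.trans hτ01.2⟩, h⟩) (not_le.2 hs.2)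
  have h0W : g 0 ∈ W r := ⟨h0.1, Metric.ball_subset_ball (by linarith) h0.2⟩
  have hτ0 : 0 < τ := lt_of_le_of_ne hτ01.1 (by rintro rfl; exact hτW h0W)
  have hsub : Icc 0 τ ⊆ Icc (0 : ℝ) 1 := Icc_subset_Icc_right hτ01.2
  have hgK : MapsTo g (Icc 0 τ) K := by
    have h2 : MapsTo g (closure (Ico 0 τ)) (closure (W r)) :=
      MapsTo.closure_of_continuousOn hbefore
        (hgc.mono (by rw [closure_Ico hτ0.ne]; exact hsub))
    rw [closure_Ico hτ0.ne] at h2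
    exact fun s hs => closure_minimal hWK hK.isClosed (h2 hs)
  set u : ℝ → E := φ ∘ g with hu
  have huc : ContinuousOn u (Icc 0 τ) :=
    hφc.comp (hgc.mono hsub) fun s hs => hKs (hgK hs)
  obtain ⟨S, hS, hSd⟩ := hγ.exists_countable_mdifferentiableAt
  have hder : ∀ s ∈ Ioo 0 τ \ S, DifferentiableAt ℝ u s ∧
      ENNReal.ofReal (ε * c) * ‖deriv u s‖ₑ ≤ kobayashiRoyden F
        (⟨γ s, (mfderiv 𝓘(ℝ, ℝ) 𝓘(ℝ, F) γ s (1 : ℝ) : F)⟩ : TangentBundle 𝓘(ℂ, F) X) := by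
    rintro s ⟨hs, hsS⟩
    have hs' : s ∈ Icc 0 τ := Ioo_subset_Icc_self hs
    obtain ⟨D, hD, hDb⟩ := hbound (g s) (hgK hs')
    have hcomp := hD.comp (γ s) (hι (γ s)).hasMFDerivAt
    have hdu := HasMFDerivAt.hasDerivAt_comp_path hcomp (hSd s ⟨hsub hs', hsS⟩)
    refine ⟨hdu.differentiableAt, le_trans ?_ (hk _ _)⟩
    have hdu' : deriv u s = _ := hdu.deriv
    rw [hdu', ← ofReal_norm, ← ENNReal.ofReal_mul (by positivity), mul_assoc]
    exact ENNReal.ofReal_le_ofReal (mul_le_mul_of_nonneg_left (hDb _).1 hε.le)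
  have hdist : r / 2 ≤ ‖u τ - u 0‖ := by
    have h3 : r ≤ dist (u τ) (φ p) := by
      by_contra h
      exact hτW ⟨hKs (hgK ⟨hτ0.le, le_rfl⟩), not_le.1 h⟩
    have h4 : dist (u 0) (φ p) < r / 2 := h0.2
    have h5 := dist_triangle (u τ) (u 0) (φ p)
    rw [← dist_eq_norm]
    linarith
  calc ENNReal.ofReal (ε * c * (r / 2))
      ≤ ENNReal.ofReal (ε * c) * ‖u τ - u 0‖ₑ := by
        rw [ENNReal.ofReal_mul (by positivity), ← ofReal_norm]
        gcongr
    _ ≤ ENNReal.ofReal (ε * c) * ∫⁻ s in Ioc 0 τ, ‖deriv u s‖ₑ := by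
        gcongr
        exact enorm_sub_le_lintegral_deriv_off_countable hτ0.le huc hS fun s hs => (hder s hs).1
    _ = ∫⁻ s in Ioc 0 τ, ENNReal.ofReal (ε * c) * ‖deriv u s‖ₑ :=
        (lintegral_const_mul' _ _ ENNReal.ofReal_ne_top).symm
    _ ≤ ∫⁻ s in Ioc 0 τ, kobayashiRoyden F
        (⟨γ s, (mfderiv 𝓘(ℝ, ℝ) 𝓘(ℝ, F) γ s (1 : ℝ) : F)⟩ : TangentBundle 𝓘(ℂ, F) X) := by
        refine setLIntegral_mono_ae' measurableSet_Ioc ?_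
        filter_upwards [(hS.insert τ).ae_notMem volume] with s hs hsτ
        rw [mem_insert_iff, not_or] at hs
        exact (hder s ⟨⟨hsτ.1, lt_of_le_of_ne hsτ.2 hs.1⟩, hs.2⟩).2
    _ ≤ kobayashiLength F γ :=
        lintegral_mono_set (Ioc_subset_Icc_self.trans hsub)

end LowerBound

/-! ### From hyperbolic imbedding to a derivative bound for discs -/

section UpperBound

variable {E : Type*} [NormedAddCommGroup E] [NormedSpace ℂ E]
  {F : Type*} [NormedAddCommGroup F] [NormedSpace ℂ F]
  {Z : Type*} [TopologicalSpace Z] {Y : Set Z} [ChartedSpace F Y]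

theorem IsHyperbolicallyImbedded.exists_pos_le_kobayashiEDist
    (hY : IsHyperbolicallyImbedded F Y) {p : Z} (hp : p ∈ closure Y) {S : Set Z}
    (hS : IsCompact S) (hSY : S ⊆ closure Y) (hpS : p ∉ S) :
    ∃ U ∈ 𝓝 p, ∃ δ : ℝ≥0∞, 0 < δ ∧ ∀ a b : Y, (a : Z) ∈ U → (b : Z) ∈ S →
      δ ≤ kobayashiEDist F a b := by
  refine hS.induction_on (p := fun S => ∃ U ∈ 𝓝 p, ∃ δ : ℝ≥0∞, 0 < δ ∧ ∀ a b : Y,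
    (a : Z) ∈ U → (b : Z) ∈ S → δ ≤ kobayashiEDist F a b) ?_ ?_ ?_ ?_
  · exact ⟨univ, Filter.univ_mem, 1, one_pos, fun _ _ _ h => h.elim⟩
  · rintro s t hst ⟨U, hU, δ, hδ, h⟩
    exact ⟨U, hU, δ, hδ, fun a b ha hb => h a b ha (hst hb)⟩
  · rintro s t ⟨U, hU, δ, hδ, h⟩ ⟨U', hU', δ', hδ', h'⟩
    refine ⟨U ∩ U', Filter.inter_mem hU hU', min δ δ', lt_min hδ hδ', fun a b ha hb => ?_⟩
    exact hb.elim (fun hb => (min_le_left _ _).trans (h a b ha.1 hb))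
      fun hb => (min_le_right _ _).trans (h' a b ha.2 hb)
  · intro q hq
    obtain ⟨U, hU, V, hV, h⟩ := hY p hp q (hSY hq) (by rintro rfl; exact hpS hq)
    exact ⟨V, mem_nhdsWithin_of_mem_nhds hV, U, hU, _, h,
      fun a b ha hb => sInf_le ⟨a, b, ha, hb, rfl⟩⟩

variable [FiniteDimensional ℂ E] [FiniteDimensional ℂ F] [T2Space Z] [ChartedSpace E Z]
  [IsManifold 𝓘(ℂ, E) 1 Z] [IsManifold 𝓘(ℂ, F) 1 Y] {L : TangentBundle 𝓘(ℂ, E) Z → ℝ}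

theorem IsHyperbolicallyImbedded.exists_nhds_forall_disc_le
    (hY : IsHyperbolicallyImbedded F Y) (hL : IsLengthFunction E Z L)
    (hι : MDifferentiable 𝓘(ℂ, F) 𝓘(ℂ, E) (Subtype.val : Y → Z)) {p : Z} (hp : p ∈ closure Y) :
    ∃ U ∈ 𝓝 p, ∃ C : ℝ, ∀ f : ℂ → Y,
      MDifferentiableOn 𝓘(ℂ, ℂ) 𝓘(ℂ, F) f (Metric.ball (0 : ℂ) 1) → (f 0 : Z) ∈ U →
      L ⟨(f 0 : Z), mfderiv 𝓘(ℂ, F) 𝓘(ℂ, E) (Subtype.val : Y → Z) (f 0)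
        (mfderiv 𝓘(ℂ, ℂ) 𝓘(ℂ, F) f 0 (1 : ℂ) : F)⟩ ≤ C := by
  have : ProperSpace E := FiniteDimensional.proper ℂ E
  have : CompleteSpace F := FiniteDimensional.complete ℂ F
  obtain ⟨r, hr, K, hK, -, hKs, hmemK⟩ :=
    exists_isCompact_chart_closedBall (E := E) (p := p) Filter.univ_mem
  obtain ⟨_, M, _, hM, hbound⟩ := hL.exists_chart_bounds p hK hKs
  set φ := extChartAt 𝓘(ℂ, E) p with hφ
  have hps : p ∈ (chartAt E p).source := mem_chart_source E p
  have hφc : ContinuousOn φ (chartAt E p).source := (chartAt E p).continuousOn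
  set W : Set Z := (chartAt E p).source ∩ φ ⁻¹' Metric.ball (φ p) r with hW
  have hWo : IsOpen W := isOpen_chart_ball p r
  have hWK : W ⊆ K := fun y hy => (hmemK y hy.1).2 (Metric.ball_subset_closedBall hy.2)
  -- Only the part of the sphere in `closure Y` matters, and only there does hyperbolic imbedding
  -- apply.
  set S : Set Z := (K ∩ φ ⁻¹' Metric.sphere (φ p) r) ∩ closure Y with hS
  have hSc : IsCompact S :=
    hK.of_isClosed_subset
      (((hφc.mono hKs).preimage_isClosed_of_isClosed hK.isClosed Metric.isClosed_sphere).inter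
        isClosed_closure) fun _ h => h.1.1
  have hpS : p ∉ S := fun h => by
    have h1 : dist (φ p) (φ p) = r := h.1.2
    rw [dist_self] at h1
    exact hr.ne h1
  obtain ⟨U, hU, δ, hδ, hdist⟩ := hY.exists_pos_le_kobayashiEDist hp hSc inter_subset_right hpS
  obtain ⟨ρ, -, hρ, hρδ⟩ := ENNReal.lt_iff_exists_real_btwn.1 hδ
  rw [ENNReal.ofReal_pos] at hρ
  -- For `‖z‖ < R` the distance from `f 0` to `f z` is at most `ρ < δ`. The radius does not depend
  -- on `f`.
  set R : ℝ := min (ρ / 2) (1 / 2) with hR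
  have hR0 : 0 < R := by positivity
  refine ⟨U ∩ W, Filter.inter_mem hU (hWo.mem_nhds ⟨hps, Metric.mem_ball_self hr⟩),
    M * (2 * r / R), fun f hf hf0 => ?_⟩
  have hsub : Metric.ball (0 : ℂ) R ⊆ Metric.ball 0 1 :=
    Metric.ball_subset_ball ((min_le_right _ _).trans (by norm_num))
  set g : ℂ → Z := fun z => (f z : Z) with hg
  have hgd : MDifferentiableOn 𝓘(ℂ, ℂ) 𝓘(ℂ, E) g (Metric.ball 0 R) :=
    hι.comp_mdifferentiableOn (hf.mono hsub)
  have havoid : ∀ z ∈ Metric.ball (0 : ℂ) R, g z ∉ S := fun z hz hzS => by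
    rw [mem_ball_zero_iff] at hz
    have h1 := hdist (f 0) (f z) hf0.1 hzS
    have h2 := kobayashiEDist_le_of_disc hf (hz.trans_le (min_le_right _ _)) hρ
      (hz.le.trans (min_le_left _ _))
    exact absurd (h1.trans h2) (not_le.2 hρδ)
  have himage : g '' Metric.ball 0 R ⊆ W := by
    have hconn : IsPreconnected (g '' Metric.ball 0 R) :=
      (convex_ball (0 : ℂ) R).isPreconnected.image g hgd.continuousOn
    -- Avoiding `S`, the connected image lies in the disjoint open sets `W` and `Kᶜ`, and it meets
    -- `W` at `g 0`.
    refine hconn.subset_left_of_subset_union hWo hK.isClosed.isOpen_compl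
      (disjoint_compl_right_iff_subset.2 hWK) ?_
      ⟨g 0, mem_image_of_mem g (Metric.mem_ball_self hR0), hf0.2⟩
    rintro _ ⟨z, hz, rfl⟩
    by_cases hzK : g z ∈ K
    · left
      have h1 : dist (φ (g z)) (φ p) ≤ r := (hmemK _ (hKs hzK)).1 hzK
      refine ⟨hKs hzK, lt_of_le_of_ne h1 fun h => ?_⟩
      exact havoid z hz ⟨⟨hzK, h⟩, subset_closure (f z).2⟩
    · exact Or.inr hzK
  have hgW : MapsTo g (Metric.ball 0 R) W := fun z hz => himage (mem_image_of_mem g hz)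
  have hud : DifferentiableOn ℂ (φ ∘ g) (Metric.ball 0 R) := by
    rw [← mdifferentiableOn_iff_differentiableOn]
    exact mdifferentiableOn_extChartAt.comp hgd fun z hz => (hgW hz).1
  have h0R : (0 : ℂ) ∈ Metric.ball (0 : ℂ) R := Metric.mem_ball_self hR0
  have hder : ‖deriv (φ ∘ g) 0‖ ≤ 2 * r / R := by
    refine Complex.norm_deriv_le_div_of_mapsTo_ball hud (fun z hz => ?_) hR0
    have h1 : dist (φ (g z)) (φ p) < r := (hgW hz).2
    have h2 : dist (φ (g 0)) (φ p) < r := (hgW h0R).2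
    have h3 := dist_triangle_right (φ (g z)) (φ (g 0)) (φ p)
    rw [Metric.mem_closedBall]
    exact h3.trans (by linarith)
  obtain ⟨D, hD, hDb⟩ := hbound (g 0) (hWK hf0.2)
  have hf0d : MDifferentiableAt 𝓘(ℂ, ℂ) 𝓘(ℂ, F) f 0 :=
    hf.mdifferentiableAt (Metric.isOpen_ball.mem_nhds (hsub h0R))
  have hcomp := (hD.comp (f 0) (hι (f 0)).hasMFDerivAt).comp (0 : ℂ) hf0d.hasMFDerivAt
  set D₁ : F →L[ℂ] E := mfderiv 𝓘(ℂ, F) 𝓘(ℂ, E) (Subtype.val : Y → Z) (f 0) with hD₁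
  set D₂ : ℂ →L[ℂ] F := mfderiv 𝓘(ℂ, ℂ) 𝓘(ℂ, F) f 0 with hD₂
  have hfd : HasFDerivAt (φ ∘ g) ((D.comp D₁).comp D₂) (0 : ℂ) :=
    hasMFDerivAt_iff_hasFDerivAt.1 hcomp
  have hdu : deriv (φ ∘ g) 0 = D (D₁ (D₂ 1)) := hfd.hasDerivAt.deriv
  rw [hdu] at hder
  exact (hDb _).2.trans (mul_le_mul_of_nonneg_left hder hM.le)

theorem IsHyperbolicallyImbedded.exists_forall_disc_le
    (hY : IsHyperbolicallyImbedded F Y) (hc : IsCompact (closure Y)) (hL : IsLengthFunction E Z L)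
    (hι : MDifferentiable 𝓘(ℂ, F) 𝓘(ℂ, E) (Subtype.val : Y → Z)) :
    ∃ C : ℝ, ∀ f : ℂ → Y, MDifferentiableOn 𝓘(ℂ, ℂ) 𝓘(ℂ, F) f (Metric.ball (0 : ℂ) 1) →
      L ⟨(f 0 : Z), mfderiv 𝓘(ℂ, F) 𝓘(ℂ, E) (Subtype.val : Y → Z) (f 0)
        (mfderiv 𝓘(ℂ, ℂ) 𝓘(ℂ, F) f 0 (1 : ℂ) : F)⟩ ≤ C := by
  have key := hc.induction_on (p := fun T => ∃ C : ℝ, ∀ f : ℂ → Y,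
    MDifferentiableOn 𝓘(ℂ, ℂ) 𝓘(ℂ, F) f (Metric.ball (0 : ℂ) 1) → (f 0 : Z) ∈ T →
      L ⟨(f 0 : Z), mfderiv 𝓘(ℂ, F) 𝓘(ℂ, E) (Subtype.val : Y → Z) (f 0)
        (mfderiv 𝓘(ℂ, ℂ) 𝓘(ℂ, F) f 0 (1 : ℂ) : F)⟩ ≤ C)
    ⟨0, fun _ _ h => h.elim⟩ (fun _ _ hst ⟨C, h⟩ => ⟨C, fun f hf h0 => h f hf (hst h0)⟩)
    (fun _ _ ⟨C, h⟩ ⟨C', h'⟩ => ⟨max C C', fun f hf h0 => h0.elim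
      (fun h0 => (h f hf h0).trans (le_max_left _ _))
      fun h0 => (h' f hf h0).trans (le_max_right _ _)⟩)
    fun p hp => by
      obtain ⟨U, hU, h⟩ := hY.exists_nhds_forall_disc_le hL hι hp
      exact ⟨U, mem_nhdsWithin_of_mem_nhds hU, h⟩
  obtain ⟨C, h⟩ := key
  exact ⟨C, fun f hf => h f hf (subset_closure (f 0).2)⟩

end UpperBound

theorem mainTheorem8
    {E : Type*} [NormedAddCommGroup E] [NormedSpace ℂ E] [FiniteDimensional ℂ E]
    {F : Type*} [NormedAddCommGroup F] [NormedSpace ℂ F] [FiniteDimensional ℂ F]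
    {Z : Type*} [TopologicalSpace Z] [T2Space Z] [ChartedSpace E Z]
    [IsManifold 𝓘(ℂ, E) ω Z]
    (Y : Set Z) [ChartedSpace F Y] [IsManifold 𝓘(ℂ, F) ω Y]
    (hY : Manifold.IsSmoothEmbedding 𝓘(ℂ, F) 𝓘(ℂ, E) ω (Subtype.val : Y → Z))
    (hc : IsCompact (closure Y))
    (L : TangentBundle 𝓘(ℂ, E) Z → ℝ) (hL : IsLengthFunction E Z L) :
    IsHyperbolicallyImbedded F Y ↔
      ∃ ε : ℝ, 0 < ε ∧ ∀ (y : Y) (v : TangentSpace 𝓘(ℂ, F) y),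
        ENNReal.ofReal
            (ε * L ⟨(y : Z), mfderiv 𝓘(ℂ, F) 𝓘(ℂ, E) (Subtype.val : Y → Z) y v⟩) ≤
          kobayashiRoyden F (⟨y, v⟩ : TangentBundle 𝓘(ℂ, F) Y) := by
  have hι : MDifferentiable 𝓘(ℂ, F) 𝓘(ℂ, E) (Subtype.val : Y → Z) :=
    hY.contMDiff.mdifferentiable (by simp)
  constructor
  · intro h
    obtain ⟨C, hC⟩ := h.exists_forall_disc_le hc hL hι
    -- The maximum with `1` keeps `ε` positive whatever the sign of `C`.
    refine ⟨(max C 1)⁻¹, by positivity, fun y v => le_sInf ?_⟩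
    rintro _ ⟨r, hr, rfl, f, hf, hfv⟩
    obtain ⟨rfl, hv⟩ := Bundle.TotalSpace.mk.inj hfv
    obtain rfl := eq_of_heq hv
    refine ENNReal.ofReal_le_ofReal ?_
    rw [inv_mul_le_iff₀ (by positivity)]
    set w : F := mfderiv 𝓘(ℂ, ℂ) 𝓘(ℂ, F) f 0 (1 : ℂ) with hw
    set D : F →L[ℂ] E := mfderiv 𝓘(ℂ, F) 𝓘(ℂ, E) (Subtype.val : Y → Z) (f 0) with hD
    have h1 : L ⟨(f 0 : Z), D ((r : ℂ) • w)⟩ = r * L ⟨(f 0 : Z), D w⟩ := by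
      rw [map_smul]
      refine (hL.map_smul _ _ _).trans ?_
      rw [Complex.norm_real, Real.norm_of_nonneg hr.le]
    have h2 : L ⟨(f 0 : Z), D w⟩ ≤ max C 1 := (hC f hf).trans (le_max_left _ _)
    refine h1.trans_le ?_
    rw [mul_comm]
    exact mul_le_mul_of_nonneg_right h2 hr.le
  · rintro ⟨ε, hε, hk⟩ p - q - hpq
    obtain ⟨U, hU, V, hV, δ, hδ, h⟩ := hL.exists_pos_le_kobayashiLength hι hε hk hpq
    refine ⟨U, hU, V, hV, (ENNReal.ofReal_pos.2 hδ).trans_le (le_sInf ?_)⟩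
    rintro _ ⟨a, b, ha, hb, rfl⟩
    refine le_sInf ?_
    rintro _ ⟨γ, hγ, rfl, rfl, rfl⟩
    exact h γ hγ ha hb
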